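/- Let $(X,d)$ be a metric space and $f_n:X\to X$, $n\ge 0$, be maps; write $f_n^0=\mathrm{id}$ and $f_n^k=f_{n+k-1}\circ\cdots\circ f_n$ for $k\ge1$. Let $A=(a_{ij})$ be an $N\times N$ transition matrix, i.e. $N\ge2$, all $a_{ij}\in\{0,1\}$, and no row and no column of $A$ is zero. Let $\Sigma_N^+(A)$ be the set of sequences $s=(s_0,s_1,\dots)$ in $\{1,\dots,N\}$ with $a_{s_j s_{j+1}}=1$ for all $j\ge 0$, with the metric $\hat\rho(s,t)=\sum_{i\ge0}\hat d(s_i,t_i)2^{-i}$, where $\hat d(a,b)=0$ if $a=b$ and $1$ otherwise, and let $\sigma_A$ be the shift $(s_0,s_1,\dots)\mapsto(s_1,s_2,\dots)$ on it. Let $\rho(A)=\lim_{n\to\infty}\|A^n\|^{1/n}$ with $\|A\|=\sum_{i,j}a_{ij}$. Let $V_1,\dots,V_N\subset X$ be nonempty with $d(V_i,V_j)=\inf\{d(x,y):x\in V_i,\,y\in V_j\}>0$ for $i\ne j$, let $V_{i,n}\subset V_i$ ($1\le i\le N$, $n\ge0$) be nonempty compact sets, put $E=\bigcup_{n\ge 0}\bigcup_{i=1}^N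 V_{i,n}$, and assume that $\{f_n\}$ is equi-continuous in $E$: for every $\epsilon>0$ there is $\delta>0$ such that $d(f_n(x),f_n(y))<\epsilon$ for all $n\ge0$ and all $x,y\in E$ with $d(x,y)<\delta$. (1) Assume $(\mathrm{H}_1)$: $\bigcap_{k=0}^{m}(f_n^{k})^{-1}(V_{s_k,n+k})\neq\emptyset$ for all $m,n\ge0$ and all $s=(s_0,s_1,\dots)\in\Sigma_N^+(A)$. Then there are nonempty compact sets $\Lambda_n\subset\bigcup_{i=1}^N V_{i,n}$, $n\ge0$, with $f_n(\Lambda_n)\subset\Lambda_{n+1}$, such that the system $\{f_n\}$ on $\{\Lambda_n\}$ is topologically equi-semiconjugate to $(\Sigma_N^+(A),\sigma_A)$: there are surjective maps $h_n:\Lambda_n\to\Sigma_N^+(A)$ with $h_{n+1}\circ f_n=\sigma_A\circ h_n$ on $\Lambda_n$ for all $n\ge 0$ which are equi-continuous, i.e. for every $\epsilon>0$ there is $\delta>0$ such that $\hat\rho(h_n(x),h_n(y))<\epsilon$ for all $n\ge 0$ and all $x,y\in\Lambda_n$ with $d(x,y)<\delta$. Moreover, if $X$ is compact, then $h(f_{0,\infty},\Lambda_0)\ge\log\rho(A)$.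 Here, for $Y\subset X$ nonempty, $$h(f_{0,\infty},Y)=\sup_{\mathcal A}\ \limsup_{n\to\infty}\frac1n\log\mathcal N\big(\mathcal A_0^n|_Y\big),$$ where $\mathcal A$ runs over the open covers of $X$, $\mathcal A_0^n=\{\bigcap_{j=0}^{n-1}(f_0^{j})^{-1}(A_j):A_0,\dots,A_{n-1}\in\mathcal A\}$, $\mathcal A_0^n|_Y=\{B\cap Y:B\in\mathcal A_0^n\}$, and $\mathcal N$ is the minimal cardinality of a subcover (of $Y$). (2) Assume, instead of $(\mathrm{H}_1)$, that the system is weakly $A$-coupled-expanding in $\{V_{i,n}\}$: for all $n\ge 0$ and all $i$, $V_{i,n}\cap V_{j,n}=\partial V_{i,n}\cap\partial V_{j,n}$ for every $j\ne i$, and $f_n(V_{i,n})\supset\bigcup_{j:\,a_{ij}=1}V_{j,n+1}$. Then all the conclusions of (1) hold with sets $\Lambda_n$ that in addition satisfy $f_n(\Lambda_n)=\Lambda_{n+1}$ for all $n\ge0$. -/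

import Mathlib

open Set Filter Topology
open scoped ENNReal

noncomputable section

namespace NDS

/-! Non-autonomous discrete systems `x (n+1) = f n (x n)` on a space `X`. -/

section Systems

variable {X Y : Type*}

/-- The composition `f_i^n = f_{i+n-1} ∘ ⋯ ∘ f_i`, with `f_i^0 = id`. -/
def iter (f : ℕ → X → X) (i : ℕ) : ℕ → X → X
  | 0 => id
  | n + 1 => f (i + n) ∘ iter f i n

/-- The distance `inf {d(a,b) : a ∈ S, b ∈ T}` between two nonempty sets. -/
def setDist [MetricSpace X] (S T : Set X) : ℝ := sInf (Set.image2 dist S T)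

/-- Equi-continuity of a sequence of maps `h_n : Λ_n → Y`: one `δ` serves all `n` and all pairs of
points of `Λ_n`. -/
def EquiContinuousIn [MetricSpace X] [MetricSpace Y] (Λ : ℕ → Set X) (h : ∀ n, Λ n → Y) : Prop :=
  ∀ ε > 0, ∃ δ > 0, ∀ n, ∀ x y : Λ n, dist x y < δ → dist (h n x) (h n y) < ε

/-- The sequence of sets `Λ_n` is invariant: `f_n(Λ_n) ⊆ Λ_{n+1}`. -/
def IsInvariant (f : ℕ → X → X) (Λ : ℕ → Set X) : Prop :=
  ∀ n, MapsTo (f n) (Λ n) (Λ (n + 1))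

/-- The invariant subsystem of `f` on `Λ` is topologically equi-semiconjugate to the invariant
subsystem of `g` on `E`: both sequences of sets are invariant and there are equi-continuous
maps `h_n` from `Λ_n` onto `E_n` with `h_{n+1} ∘ f_n = g_n ∘ h_n` on `Λ_n`. -/
def EquiSemiconjugate [MetricSpace X] [MetricSpace Y] (f : ℕ → X → X) (Λ : ℕ → Set X)
    (g : ℕ → Y → Y) (E : ℕ → Set Y) : Prop :=
  ∃ hΛ : IsInvariant f Λ, IsInvariant g E ∧ ∃ h : ∀ n, Λ n → Y,
    (∀ n, range (h n) = E n) ∧ EquiContinuousIn Λ h ∧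
      ∀ n (x : Λ n), h (n + 1) ⟨f n x, hΛ n x.2⟩ = g n (h n x)

end Systems

/-! Topological entropy through open covers. -/

section Entropy

variable {X : Type*}

/-- The minimal cardinality of a subfamily of `C` that covers `Y`
(`⊤` if there is no finite one). -/
def minCard (C : Set (Set X)) (Y : Set X) : ℕ∞ :=
  sInf {k | ∃ D : Set (Set X), D ⊆ C ∧ Y ⊆ ⋃₀ D ∧ k = D.encard}

/-- The trace `{A ∩ Y : A ∈ C}` of a family of sets on `Y`. -/
def trace (C : Set (Set X)) (Y : Set X) : Set (Set X) := (fun A => A ∩ Y) '' C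

/-- The family of all `⋂_{j<n} f_0^{-j}(A_j)` with `A_0, …, A_{n-1} ∈ C`. -/
def iterCover (f : ℕ → X → X) (C : Set (Set X)) (n : ℕ) : Set (Set X) :=
  {B | ∃ a : Fin n → Set X, (∀ j, a j ∈ C) ∧ B = ⋂ j : Fin n, iter f 0 j ⁻¹' a j}

/-- `C` is an open cover of the whole space. -/
def IsOpenCoverOf [TopologicalSpace X] (C : Set (Set X)) : Prop :=
  (∀ U ∈ C, IsOpen U) ∧ ⋃₀ C = univ

/-- The topological entropy `h(f_{0,∞}, Y)` of the system on the subset `Y` (of a compact space):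
the supremum over all open covers `C` of `X` of the upper limit of
`log N(C_0^n restricted to Y) / n`, with extended real values. -/
def entropy [TopologicalSpace X] (f : ℕ → X → X) (Y : Set X) : EReal :=
  ⨆ C : {C : Set (Set X) // IsOpenCoverOf C},
    limsup (fun n : ℕ =>
      ENNReal.log ((minCard (trace (iterCover f C.1 n) Y) Y : ℕ∞) : ℝ≥0∞) / (n : EReal)) atTop

end Entropy

/-! Transition matrices and subshifts of finite type. The symbols are the elements of `Fin N`. -/

section Symbolic

variable {N : ℕ}

/-- An `N × N` transition matrix, `N ≥ 2`: entries `0` or `1`, no zero row, no zero column. -/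
structure IsTransitionMatrix (A : Matrix (Fin N) (Fin N) ℕ) : Prop where
  two_le : 2 ≤ N
  zero_or_one : ∀ i j, A i j = 0 ∨ A i j = 1
  row : ∀ i, 1 ≤ ∑ j, A i j
  col : ∀ j, 1 ≤ ∑ i, A i j

/-- The norm `‖A‖ = ∑ a_{ij}`. -/
def entrySum (A : Matrix (Fin N) (Fin N) ℕ) : ℝ := ∑ i, ∑ j, (A i j : ℝ)

/-- `ρ(A) = lim ‖A^n‖^{1/n}`. -/
def rho (A : Matrix (Fin N) (Fin N) ℕ) : ℝ :=
  limUnder atTop (fun n : ℕ => entrySum (A ^ n) ^ (1 / (n : ℝ)))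

theorem entrySum_mul_le (A B : Matrix (Fin N) (Fin N) ℕ) :
    entrySum (A * B) ≤ entrySum A * entrySum B := by
  have h1 : entrySum (A * B) = ∑ k, (∑ i, (A i k : ℝ)) * ∑ j, (B k j : ℝ) := by
    simp only [entrySum, Matrix.mul_apply, Nat.cast_sum, Nat.cast_mul, Finset.sum_mul_sum]
    rw [Finset.sum_comm' (t' := Finset.univ) (s' := fun _ => Finset.univ) (by simp)]
    rw [Finset.sum_congr rfl fun _ _ => Finset.sum_congr rfl fun _ _ => rfl]
    rw [Finset.sum_comm]
    rw [Finset.sum_congr rfl fun _ _ => Finset.sum_comm]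
    rw [Finset.sum_comm]
  have h2 : entrySum A = ∑ k, ∑ i, (A i k : ℝ) := Finset.sum_comm
  rw [h1, h2, Finset.sum_mul]
  refine Finset.sum_le_sum fun k _ => mul_le_mul_of_nonneg_left ?_ (by positivity)
  exact Finset.single_le_sum (f := fun k => ∑ j, (B k j : ℝ)) (fun _ _ => by positivity)
    (Finset.mem_univ k)

theorem one_le_entrySum_pow {A : Matrix (Fin N) (Fin N) ℕ} (hA : IsTransitionMatrix A) (n : ℕ) :
    1 ≤ entrySum (A ^ n) := by
  have hrow : ∀ i, 1 ≤ ∑ j, (A ^ n) i j := by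
    induction n with
    | zero => intro i; simp [Matrix.one_apply]
    | succ n ih =>
      intro i
      simp only [pow_succ, Matrix.mul_apply]
      rw [Finset.sum_comm]
      refine (ih i).trans (Finset.sum_le_sum fun k _ => ?_)
      rw [← Finset.mul_sum]
      exact Nat.le_mul_of_pos_right _ (hA.row k)
  have h0 : 0 < N := by have := hA.two_le; omega
  have h1 : (1 : ℝ) ≤ ∑ j, ((A ^ n) ⟨0, h0⟩ j : ℝ) := by exact_mod_cast hrow ⟨0, h0⟩
  exact h1.trans (Finset.single_le_sum (f := fun i => ∑ j, ((A ^ n) i j : ℝ))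
    (fun _ _ => by positivity) (Finset.mem_univ _))

/-- The limit that defines `ρ(A)` exists. -/
theorem tendsto_rho {A : Matrix (Fin N) (Fin N) ℕ} (hA : IsTransitionMatrix A) :
    Tendsto (fun n : ℕ => entrySum (A ^ n) ^ (1 / (n : ℝ))) atTop (𝓝 (rho A)) := by
  have hsub : Subadditive fun n => Real.log (entrySum (A ^ n)) := by
    intro m n
    have hm := one_le_entrySum_pow hA m
    have hn := one_le_entrySum_pow hA n
    have hmn := one_le_entrySum_pow hA (m + n)
    rw [← Real.log_mul (by positivity) (by positivity)]
    refine Real.log_le_log (by positivity) ?_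
    rw [pow_add]
    exact entrySum_mul_le _ _
  have hb : BddBelow (range fun n : ℕ => Real.log (entrySum (A ^ n)) / n) :=
    ⟨0, by
      rintro _ ⟨n, rfl⟩
      exact div_nonneg (Real.log_nonneg (one_le_entrySum_pow hA n)) (Nat.cast_nonneg n)⟩
  refine tendsto_nhds_limUnder ⟨Real.exp hsub.lim, ?_⟩
  refine ((Real.continuous_exp.tendsto _).comp (hsub.tendsto_lim hb)).congr fun n => ?_
  have hn := one_le_entrySum_pow hA n
  rw [Real.rpow_def_of_pos (by positivity)]
  simp [div_eq_mul_inv]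

/-- The space `Σ_N^+(A)` of the one-sided sequences `s` with `a_{s_j s_{j+1}} = 1` for all `j`. -/
def Subshift (A : Matrix (Fin N) (Fin N) ℕ) : Type :=
  {s : ℕ → Fin N // ∀ j, A (s j) (s (j + 1)) = 1}

/-- The distance `ρ̂(α, β) = ∑ d̂(a_i, b_i) / 2^i` with `d̂` the discrete `0`-`1` distance. -/
def seqDist (α β : ℕ → Fin N) : ℝ := ∑' i, (if α i = β i then (0 : ℝ) else 1) / 2 ^ i

theorem summable_seqDist (α β : ℕ → Fin N) :
    Summable fun i => (if α i = β i then (0 : ℝ) else 1) / 2 ^ i := by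
  refine Summable.of_nonneg_of_le (fun i => ?_) (fun i => ?_) summable_geometric_two
  · split_ifs <;> positivity
  · rw [one_div, inv_pow, div_eq_mul_inv]
    refine mul_le_of_le_one_left (by positivity) ?_
    split_ifs <;> norm_num

theorem eq_of_seqDist_eq_zero {α β : ℕ → Fin N} (h : seqDist α β = 0) : α = β := by
  funext i
  have hs : HasSum _ (seqDist α β) := (summable_seqDist α β).hasSum
  rw [h] at hs
  have h0 := (hasSum_zero_iff_of_nonneg (fun i => by
    change (0 : ℝ) ≤ _ / _
    split_ifs <;> positivity)).1 hs
  have hi := congrFun h0 i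
  by_contra hne
  simp [hne] at hi

instance instMetricSpaceSubshift (A : Matrix (Fin N) (Fin N) ℕ) : MetricSpace (Subshift A) where
  dist α β := seqDist α.1 β.1
  dist_self α := by simp [seqDist]
  dist_comm α β := by simp [seqDist, eq_comm]
  dist_triangle α β γ := by
    rw [seqDist, seqDist, seqDist,
      ← (summable_seqDist α.1 β.1).tsum_add (summable_seqDist β.1 γ.1)]
    refine (summable_seqDist α.1 γ.1).tsum_le_tsum (fun i => ?_)
      ((summable_seqDist α.1 β.1).add (summable_seqDist β.1 γ.1))
    rw [← add_div]
    gcongr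
    split_ifs <;> simp_all
  eq_of_dist_eq_zero {α β} h := Subtype.ext (eq_of_seqDist_eq_zero h)

/-- The shift `σ_A (s_0, s_1, s_2, …) = (s_1, s_2, …)`. -/
def shift (A : Matrix (Fin N) (Fin N) ℕ) (s : Subshift A) : Subshift A :=
  ⟨fun j => s.1 (j + 1), fun j => s.2 (j + 1)⟩

variable {X : Type*}

/-- `V_α^{m,n} = ⋂_{k=0}^m f_n^{-k}(V_{a_k, n+k})`. -/
def cylinder (f : ℕ → X → X) (V : Fin N → ℕ → Set X) (α : ℕ → Fin N) (m n : ℕ) : Set X :=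
  ⋂ k ∈ Set.Iic m, iter f n k ⁻¹' V (α k) (n + k)

/-- The system `f` is weakly `A`-coupled-expanding in the sets `V_{i,n}`. -/
def WeaklyCoupledExpanding [TopologicalSpace X] (f : ℕ → X → X) (A : Matrix (Fin N) (Fin N) ℕ)
    (V : Fin N → ℕ → Set X) : Prop :=
  (∀ i n, (V i n).Nonempty) ∧
  (∀ i j n, i ≠ j → V i n ∩ V j n = frontier (V i n) ∩ frontier (V j n)) ∧
  ∀ i n, (⋃ j ∈ {j | A i j = 1}, V j (n + 1)) ⊆ f n '' V i n

end Symbolic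

end NDS

end

open NDS

/-! Take for `Λ n` the points whose orbit from time `n` follows some admissible sequence through the
sets `W` (`itinerarySet`). Distinct `V i` are a distance `η` apart, so such a point has exactly one
itinerary; this defines `h n`, and passing to the image under `f n` shifts it. Surjectivity is
Cantor's intersection theorem for nested compact cylinders (`exists_forall_iter_mem`).
Equi-continuity holds because close points stay `η`-close for `m` steps, uniformly in `n`, and so
share `m` symbols. Compactness follows from writing `Λ n` as an intersection of finite unions of
cylinders (`itinerarySet_eq_iInter`). For the entropy, an element of the iterated cover by sets of
diameter at most `η` meets only one word, and there are at least `‖A^n‖` words of length `n + 1`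
(`card_words_le_minCard`). In part (2), expansion yields nonempty cylinders by pulling points back,
and nonzero columns of `A` make `f n` map `Λ n` onto `Λ (n + 1)`. -/

namespace NDS

/-! ### Uniform separation of the sets `V i` -/

section Separation

variable {X : Type*} [MetricSpace X] {N : ℕ}

/-- Finitely many sets with positive mutual distances have a common separation constant. -/
theorem exists_separation {V : Fin N → Set X} (hV : ∀ i j, i ≠ j → 0 < setDist (V i) (V j)) :
    ∃ η > 0, ∀ i j x y, x ∈ V i → y ∈ V j → dist x y < η → i = j := by
  have h : ∀ᶠ η in 𝓝[>] (0 : ℝ), ∀ i j, i ≠ j → η < setDist (V i) (V j) := by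
    refine eventually_all.2 fun i => eventually_all.2 fun j => ?_
    by_cases hij : i = j
    · simp [hij]
    · filter_upwards [nhdsWithin_le_nhds (Iio_mem_nhds (hV i j hij))] with η hη _ using hη
  obtain ⟨η, hη, h0⟩ := (h.and self_mem_nhdsWithin).exists
  refine ⟨η, h0, fun i j x y hx hy hxy => ?_⟩
  by_contra hij
  have hle : setDist (V i) (V j) ≤ dist x y :=
    csInf_le ⟨0, by rintro _ ⟨a, _, b, _, rfl⟩; exact dist_nonneg⟩ ⟨x, hx, y, hy, rfl⟩
  linarith [hη i j hij]

end Separation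

/-! ### Compositions and their equi-continuity -/

section Iteration

variable {X : Type*}

theorem iter_succ_apply (f : ℕ → X → X) (n k : ℕ) (x : X) :
    iter f n (k + 1) x = f (n + k) (iter f n k x) := rfl

theorem iter_succ_apply' (f : ℕ → X → X) (n k : ℕ) (x : X) :
    iter f n (k + 1) x = iter f (n + 1) k (f n x) := by
  induction k with
  | zero => rfl
  | succ k ih =>
    rw [iter_succ_apply, ih, iter_succ_apply, show n + 1 + k = n + (k + 1) by omega]

/-- Iterates of an equi-continuous sequence, up to a fixed order, are equi-continuous along orbits
that stay in the set. -/
theorem exists_delta_iter [MetricSpace X] {f : ℕ → X → X} {E : Set X}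
    (hf : EquiContinuousIn (fun _ => E) (fun n x => f n x)) (m : ℕ) {ε : ℝ} (hε : 0 < ε) :
    ∃ δ > 0, ∀ n x y, (∀ k < m, iter f n k x ∈ E) → (∀ k < m, iter f n k y ∈ E) →
      dist x y < δ → ∀ k ≤ m, dist (iter f n k x) (iter f n k y) < ε := by
  induction m generalizing ε with
  | zero =>
    refine ⟨ε, hε, fun n x y _ _ hxy k hk => ?_⟩
    obtain rfl : k = 0 := by omega
    exact hxy
  | succ m ih =>
    obtain ⟨δ₁, hδ₁, h₁⟩ := hf ε hε
    obtain ⟨δ, hδ, h⟩ := ih (lt_min hε hδ₁)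
    refine ⟨δ, hδ, fun n x y hx hy hxy k hk => ?_⟩
    have hm := h n x y (fun k hk => hx k (by omega)) (fun k hk => hy k (by omega)) hxy
    rcases Nat.le_succ_iff.1 hk with hk | rfl
    · exact (hm k hk).trans_le (min_le_left _ _)
    · exact h₁ (n + m) ⟨_, hx m (by omega)⟩ ⟨_, hy m (by omega)⟩
        ((hm m le_rfl).trans_le (min_le_right _ _))

end Iteration

/-! ### Compactness and nonemptiness of cylinders -/

section Cylinders

variable {X : Type*} {N : ℕ} {f : ℕ → X → X} {W : Fin N → ℕ → Set X}

theorem mem_cylinder {α : ℕ → Fin N} {m n : ℕ} {x : X} :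
    x ∈ cylinder f W α m n ↔ ∀ k ≤ m, iter f n k x ∈ W (α k) (n + k) := by
  simp [cylinder]

theorem cylinder_succ (α : ℕ → Fin N) (m n : ℕ) :
    cylinder f W α (m + 1) n =
      cylinder f W α m n ∩ iter f n (m + 1) ⁻¹' W (α (m + 1)) (n + (m + 1)) := by
  ext x
  simp only [mem_inter_iff, mem_cylinder, mem_preimage, Nat.le_succ_iff]
  exact ⟨fun h => ⟨fun k hk => h k (.inl hk), h _ (.inr rfl)⟩,
    fun h k hk => hk.elim (h.1 k) fun e => e ▸ h.2⟩

theorem cylinder_congr {α β : ℕ → Fin N} {m : ℕ} (n : ℕ) (h : ∀ k ≤ m, α k = β k) :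
    cylinder f W α m n = cylinder f W β m n := by
  ext x
  simp only [mem_cylinder]
  exact forall₂_congr fun k hk => by rw [h k hk]

/-- Points of the cylinder stay in the equi-continuity set at times `0, …, m`, which controls one
iterate more, the `(m + 1)`-st. -/
theorem continuousOn_iter_cylinder [MetricSpace X]
    (hf : EquiContinuousIn (fun _ => ⋃ n, ⋃ i, W i n) (fun n x => f n x))
    (α : ℕ → Fin N) (m n : ℕ) : ContinuousOn (iter f n (m + 1)) (cylinder f W α m n) := by
  have hE : ∀ x ∈ cylinder f W α m n, ∀ k < m + 1, iter f n k x ∈ ⋃ n, ⋃ i, W i n :=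
    fun x hx k hk => mem_iUnion₂.2 ⟨_, _, mem_cylinder.1 hx k (by omega)⟩
  refine Metric.continuousOn_iff.2 fun x hx ε hε => ?_
  obtain ⟨δ, hδ, h⟩ := exists_delta_iter hf (m + 1) hε
  exact ⟨δ, hδ, fun y hy hyx => h n y x (hE y hy) (hE x hx) hyx _ le_rfl⟩

/-- The maps need not be continuous on `X`, so closedness is obtained inductively: each cylinder is
relatively closed in the preceding one. -/
theorem isCompact_cylinder [MetricSpace X] (hW : ∀ i n, IsCompact (W i n))
    (hf : EquiContinuousIn (fun _ => ⋃ n, ⋃ i, W i n) (fun n x => f n x))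
    (α : ℕ → Fin N) (m n : ℕ) : IsCompact (cylinder f W α m n) := by
  induction m with
  | zero =>
    convert hW (α 0) n using 1
    ext x
    simp [mem_cylinder, iter]
  | succ m ih =>
    rw [cylinder_succ]
    exact ih.of_isClosed_subset ((continuousOn_iter_cylinder hf α m n).preimage_isClosed_of_isClosed
      ih.isClosed (hW _ _).isClosed) inter_subset_left

theorem exists_forall_iter_mem [MetricSpace X] (hW : ∀ i n, IsCompact (W i n))
    (hf : EquiContinuousIn (fun _ => ⋃ n, ⋃ i, W i n) (fun n x => f n x))
    {α : ℕ → Fin N} {n : ℕ} (hne : ∀ m, (cylinder f W α m n).Nonempty) :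
    ∃ x, ∀ k, iter f n k x ∈ W (α k) (n + k) := by
  obtain ⟨x, hx⟩ := IsCompact.nonempty_iInter_of_sequence_nonempty_isCompact_isClosed
    (fun m => cylinder f W α m n) (fun m => by rw [cylinder_succ]; exact inter_subset_left) hne
    (isCompact_cylinder hW hf α 0 n) (fun m => (isCompact_cylinder hW hf α m n).isClosed)
  exact ⟨x, fun k => mem_cylinder.1 (mem_iInter.1 hx k) k le_rfl⟩

/-- Under weak `A`-coupled expansion all cylinders along admissible sequences are nonempty. -/
theorem WeaklyCoupledExpanding.cylinder_nonempty [TopologicalSpace X]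
    {A : Matrix (Fin N) (Fin N) ℕ} (h : WeaklyCoupledExpanding f A W) (m n : ℕ) (α : Subshift A) :
    (cylinder f W α.1 m n).Nonempty := by
  induction m generalizing n α with
  | zero =>
    obtain ⟨x, hx⟩ := h.1 (α.1 0) n
    refine ⟨x, mem_cylinder.2 fun k hk => ?_⟩
    obtain rfl : k = 0 := by omega
    exact hx
  | succ m ih =>
    -- The induction peels off the first symbol: a point following the shifted sequence from time `n
    -- + 1` is pulled back into `W (α.1 0) n`.
    obtain ⟨y, hy⟩ := ih (n + 1) (shift A α)
    rw [mem_cylinder] at hy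
    obtain ⟨x, hx, rfl⟩ := h.2.2 (α.1 0) n (mem_iUnion₂.2 ⟨α.1 1, α.2 0, hy 0 (by omega)⟩)
    refine ⟨x, mem_cylinder.2 fun k hk => ?_⟩
    cases k with
    | zero => exact hx
    | succ k =>
      rw [iter_succ_apply', ← Nat.add_assoc, Nat.add_right_comm]
      exact hy k (by omega)

end Cylinders

/-! ### Counting admissible words; growth rate and metric of the subshift -/

section Words

variable {N : ℕ} {A : Matrix (Fin N) (Fin N) ℕ}

/-- The admissible words of length `n + 1` that begin with `i`. -/
def words (A : Matrix (Fin N) (Fin N) ℕ) (n : ℕ) (i : Fin N) : Finset (Fin (n + 1) → Fin N) :=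
  Finset.univ.filter fun w => w 0 = i ∧ ∀ j : Fin n, A (w j.castSucc) (w j.succ) = 1

theorem IsTransitionMatrix.exists_succ (hA : IsTransitionMatrix A) (i : Fin N) :
    ∃ j, A i j = 1 := by
  by_contra! h
  have := hA.row i
  rw [Finset.sum_eq_zero fun j _ => (hA.zero_or_one i j).resolve_right (h j)] at this
  omega

theorem IsTransitionMatrix.exists_pred (hA : IsTransitionMatrix A) (j : Fin N) :
    ∃ i, A i j = 1 := by
  by_contra! h
  have := hA.col j
  rw [Finset.sum_eq_zero fun i _ => (hA.zero_or_one i j).resolve_right (h i)] at this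
  omega

/-- Every admissible word is a prefix of an admissible sequence. -/
theorem IsTransitionMatrix.exists_extension (hA : IsTransitionMatrix A) {n : ℕ}
    (w : Fin (n + 1) → Fin N) (hw : ∀ j : Fin n, A (w j.castSucc) (w j.succ) = 1) :
    ∃ α : Subshift A, ∀ j, α.1 (j : Fin (n + 1)) = w j := by
  choose s hs using hA.exists_succ
  -- Truncated subtraction makes this read `w` up to index `n`; afterwards the successor map `s` is
  -- iterated on the last letter.
  refine ⟨⟨fun k => s^[k - n] (w ⟨min k n, by omega⟩), fun k => ?_⟩, fun j => ?_⟩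
  · rcases lt_or_ge k n with hk | hk
    · have h1 : k - n = 0 := by omega
      have h2 : k + 1 - n = 0 := by omega
      have h3 : min k n = k := by omega
      have h4 : min (k + 1) n = k + 1 := by omega
      simp only [h1, h2, h3, h4, Function.iterate_zero, id]
      exact hw ⟨k, hk⟩
    · have h1 : k + 1 - n = k - n + 1 := by omega
      have h3 : min k n = n := by omega
      have h4 : min (k + 1) n = n := by omega
      simp only [h1, h3, h4, Function.iterate_succ_apply']
      exact hs _
  · have h1 : (j : ℕ) - n = 0 := by omega
    have h2 : min (j : ℕ) n = j := by omega
    simp only [h1, h2, Function.iterate_zero, id]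

theorem IsTransitionMatrix.nonempty_subshift (hA : IsTransitionMatrix A) :
    Nonempty (Subshift A) :=
  have h0 : 0 < N := by have := hA.two_le; omega
  let ⟨α, _⟩ := hA.exists_extension (n := 0) (fun _ => ⟨0, h0⟩) fun j => j.elim0
  ⟨α⟩

/-- Expand `A ^ (n + 1)` along its first step: prepending `i` to words that begin with a successor
`k` of `i` is injective, as `k` remains visible as the second letter. -/
theorem IsTransitionMatrix.sum_pow_le_card_words (hA : IsTransitionMatrix A) (n : ℕ) (i : Fin N) :
    ∑ j, (A ^ n) i j ≤ (words A n i).card := by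
  induction n generalizing i with
  | zero =>
    have : (fun _ => i) ∈ words A 0 i := by simp [words]
    simpa [Matrix.one_apply] using Finset.card_pos.2 ⟨_, this⟩
  | succ n ih =>
    calc ∑ j, (A ^ (n + 1)) i j = ∑ k, A i k * ∑ j, (A ^ n) k j := by
          simp only [pow_succ', Matrix.mul_apply, Finset.mul_sum]
          exact Finset.sum_comm
      _ ≤ ∑ k, A i k * (words A n k).card := by gcongr with k; exact ih k
      _ = ∑ k with A i k = 1, (words A n k).card := by
          rw [Finset.sum_filter]
          refine Finset.sum_congr rfl fun k _ => ?_
          rcases hA.zero_or_one i k with h | h <;> simp [h]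
      _ = ((Finset.univ.filter fun k => A i k = 1).sigma (words A n)).card :=
          (Finset.card_sigma _ _).symm
      _ ≤ (words A (n + 1) i).card := by
          refine Finset.card_le_card_of_injOn (fun p => Fin.cons i p.2) ?_ ?_
          · rintro ⟨k, w⟩ hp
            simp only [words, Finset.coe_sigma, Set.mem_sigma_iff, Finset.coe_filter,
              Finset.mem_univ, true_and, mem_ofPred_eq] at hp ⊢
            refine ⟨rfl, fun j => ?_⟩
            cases j using Fin.cases with
            | zero =>
              simpa [hp.2.1] using hp.1
            | succ j => simpa using hp.2.2 j
          · rintro ⟨k, w⟩ hp ⟨k', w'⟩ hp' h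
            obtain rfl : w = w' := Fin.cons_right_injective _ h
            simp only [words, Finset.coe_sigma, Set.mem_sigma_iff, Finset.coe_filter,
              Finset.mem_univ, true_and, mem_ofPred_eq] at hp hp'
            obtain rfl : k = k' := hp.2.1.symm.trans hp'.2.1
            rfl

/-- There are at least `‖A^n‖` admissible words of length `n + 1`. -/
theorem IsTransitionMatrix.entrySum_pow_le (hA : IsTransitionMatrix A) (n : ℕ) :
    entrySum (A ^ n) ≤ (Finset.univ.biUnion (words A n)).card := by
  rw [Finset.card_biUnion]
  · simp only [entrySum, Nat.cast_sum]
    exact Finset.sum_le_sum fun i _ => by exact_mod_cast hA.sum_pow_le_card_words n i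
  · intro i _ j _ hij
    refine Finset.disjoint_left.2 fun w hw hw' => hij ?_
    simp only [words, Finset.mem_filter] at hw hw'
    exact hw.2.1.symm.trans hw'.2.1

theorem IsTransitionMatrix.tendsto_log_entrySum (hA : IsTransitionMatrix A) :
    Tendsto (fun n : ℕ => Real.log (entrySum (A ^ n)) / n) atTop (𝓝 (Real.log (rho A))) := by
  have h1 : 1 ≤ rho A := ge_of_tendsto' (tendsto_rho hA) fun n =>
    Real.one_le_rpow (one_le_entrySum_pow hA n) (by positivity)
  refine ((Real.continuousAt_log (by positivity)).tendsto.comp (tendsto_rho hA)).congr fun n => ?_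
  have := one_le_entrySum_pow hA n
  rw [Function.comp_apply, Real.log_rpow (by positivity)]
  ring

/-- Words of length `n` are counted by `A ^ (n - 1)`, while entropy divides by `n`; the factor `n /
(n + 1)` absorbs the discrepancy. -/
theorem IsTransitionMatrix.tendsto_log_entrySum_pred (hA : IsTransitionMatrix A) :
    Tendsto (fun n : ℕ => Real.log (entrySum (A ^ (n - 1))) / n) atTop
      (𝓝 (Real.log (rho A))) := by
  have h := (tendsto_natCast_div_add_atTop (1 : ℝ)).mul hA.tendsto_log_entrySum
  rw [one_mul] at h
  refine (tendsto_add_atTop_iff_nat 1).1 (h.congr' ?_)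
  filter_upwards [eventually_gt_atTop 0] with n hn
  have : (n : ℝ) ≠ 0 := by positivity
  push_cast [Nat.add_sub_cancel]
  field_simp

theorem dist_subshift_le {α β : Subshift A} {m : ℕ} (h : ∀ k < m, α.1 k = β.1 k) :
    dist α β ≤ 2 * (1 / 2) ^ m := by
  have hs := summable_seqDist α.1 β.1
  have h0 : ∑ i ∈ Finset.range m, (if α.1 i = β.1 i then (0 : ℝ) else 1) / 2 ^ i = 0 :=
    Finset.sum_eq_zero fun i hi => by simp [h i (Finset.mem_range.1 hi)]
  have hg : Summable fun i : ℕ => (1 / 2 : ℝ) ^ m * (1 / 2) ^ i :=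
    summable_geometric_two.mul_left _
  calc dist α β = ∑' i, (if α.1 i = β.1 i then (0 : ℝ) else 1) / 2 ^ i := rfl
    _ = ∑' i, (if α.1 (i + m) = β.1 (i + m) then (0 : ℝ) else 1) / 2 ^ (i + m) := by
      rw [← hs.sum_add_tsum_nat_add m, h0, zero_add]
    _ ≤ ∑' i : ℕ, (1 / 2 : ℝ) ^ m * (1 / 2) ^ i := by
      refine ((summable_nat_add_iff m).2 hs).tsum_le_tsum (fun i => ?_) hg
      rw [← pow_add, add_comm m i, one_div, inv_pow, div_eq_mul_inv]
      refine mul_le_of_le_one_left (by positivity) ?_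
      split_ifs <;> norm_num
    _ = 2 * (1 / 2) ^ m := by rw [tsum_mul_left, tsum_geometric_two]; ring

end Words

/-! ### The invariant sets, the semiconjugacy and the entropy bound -/

section InvariantSets

variable {X : Type*} {N : ℕ}

/-- The points whose orbit, started at time `n`, follows the sets `W` along some sequence of the
subshift. -/
def itinerarySet (f : ℕ → X → X) (A : Matrix (Fin N) (Fin N) ℕ) (W : Fin N → ℕ → Set X) (n : ℕ) :
    Set X :=
  {x | ∃ α : Subshift A, ∀ k, iter f n k x ∈ W (α.1 k) (n + k)}

variable {f : ℕ → X → X} {A : Matrix (Fin N) (Fin N) ℕ} {W : Fin N → ℕ → Set X}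

theorem itinerarySet_subset (n : ℕ) : itinerarySet f A W n ⊆ ⋃ i, W i n :=
  fun _ ⟨α, hα⟩ => mem_iUnion.2 ⟨α.1 0, hα 0⟩

theorem itinerary_apply {n : ℕ} {x : X} {α : Subshift A}
    (h : ∀ k, iter f n k x ∈ W (α.1 k) (n + k)) (k : ℕ) :
    iter f (n + 1) k (f n x) ∈ W ((shift A α).1 k) (n + 1 + k) := by
  rw [← iter_succ_apply', Nat.add_right_comm]
  exact h (k + 1)

theorem isInvariant_itinerarySet : IsInvariant f (itinerarySet f A W) :=
  fun _ _ ⟨α, hα⟩ => ⟨shift A α, itinerary_apply hα⟩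

/-- A nonzero column supplies a symbol to prepend to the itinerary of `y`, and expansion supplies a
preimage of `y` in the corresponding set. -/
theorem image_itinerarySet [TopologicalSpace X] (hA : IsTransitionMatrix A)
    (h : WeaklyCoupledExpanding f A W) (n : ℕ) :
    f n '' itinerarySet f A W n = itinerarySet f A W (n + 1) := by
  refine (isInvariant_itinerarySet n).image_subset.antisymm ?_
  rintro y ⟨α, hα⟩
  obtain ⟨i, hi⟩ := hA.exists_pred (α.1 0)
  obtain ⟨x, hx, rfl⟩ := h.2.2 i n (mem_iUnion₂.2 ⟨α.1 0, hi, hα 0⟩)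
  refine ⟨x, ⟨⟨fun k => Nat.casesOn k i α.1, fun k => ?_⟩, fun k => ?_⟩, rfl⟩
  · cases k with
    | zero => exact hi
    | succ k => exact α.2 k
  · cases k with
    | zero => exact hx
    | succ k =>
      rw [iter_succ_apply', ← Nat.add_assoc, Nat.add_right_comm]
      exact hα k

theorem itinerarySet_eq_iInter (hsep : ∀ i j n, ∀ x ∈ W i n, x ∈ W j n → i = j) (n : ℕ) :
    itinerarySet f A W n = ⋂ m, ⋃ α : Subshift A, cylinder f W α.1 m n := by
  ext x
  simp only [mem_iInter, mem_iUnion, mem_cylinder]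
  refine ⟨fun ⟨α, hα⟩ m => ⟨α, fun k _ => hα k⟩, fun h => ?_⟩
  choose α hα using h
  -- Diagonal choice: by disjointness the sequences `α k` and `α (k + 1)` agree at index `k`, so the
  -- diagonal is admissible.
  refine ⟨⟨fun k => (α k).1 k, fun k => ?_⟩, fun k => hα k k le_rfl⟩
  change A ((α k).1 k) ((α (k + 1)).1 (k + 1)) = 1
  rw [hsep _ _ _ _ (hα k k le_rfl) (hα (k + 1) k (by omega))]
  exact (α (k + 1)).2 k

/-- A cylinder depends only on the first `m + 1` symbols, so the union is really finite: one
representative per prefix suffices. -/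
theorem isCompact_iUnion_cylinder [MetricSpace X] (hW : ∀ i n, IsCompact (W i n))
    (hf : EquiContinuousIn (fun _ => ⋃ n, ⋃ i, W i n) (fun n x => f n x)) (m n : ℕ) :
    IsCompact (⋃ α : Subshift A, cylinder f W α.1 m n) := by
  let r : Subshift A → Fin (m + 1) → Fin N := fun α k => α.1 k
  have h : (⋃ α : Subshift A, cylinder f W α.1 m n) =
      ⋃ w : range r, cylinder f W w.2.choose.1 m n := by
    ext x
    simp only [mem_iUnion]
    refine ⟨fun ⟨α, hα⟩ => ⟨⟨r α, α, rfl⟩, ?_⟩, fun ⟨w, hw⟩ => ⟨_, hw⟩⟩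
    rwa [cylinder_congr n fun k hk => ?_]
    exact congrFun (Exists.choose_spec (⟨α, rfl⟩ : ∃ y, r y = r α)) ⟨k, by omega⟩
  rw [h]
  exact isCompact_iUnion fun w => isCompact_cylinder hW hf _ m n

theorem isCompact_itinerarySet [MetricSpace X] (hW : ∀ i n, IsCompact (W i n))
    (hsep : ∀ i j n, ∀ x ∈ W i n, x ∈ W j n → i = j)
    (hf : EquiContinuousIn (fun _ => ⋃ n, ⋃ i, W i n) (fun n x => f n x)) (n : ℕ) :
    IsCompact (itinerarySet f A W n) := by
  rw [itinerarySet_eq_iInter hsep]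
  exact (isCompact_iUnion_cylinder hW hf 0 n).of_isClosed_subset
    (isClosed_iInter fun m => (isCompact_iUnion_cylinder hW hf m n).isClosed) (iInter_subset _ 0)

theorem equiSemiconjugate_itinerarySet [MetricSpace X] {η : ℝ} (hη : 0 < η)
    (hsep : ∀ i j n, ∀ x ∈ W i n, ∀ y ∈ W j n, dist x y < η → i = j)
    (hf : EquiContinuousIn (fun _ => ⋃ n, ⋃ i, W i n) (fun n x => f n x))
    (hne : ∀ n (α : Subshift A), ∃ x, ∀ k, iter f n k x ∈ W (α.1 k) (n + k)) :
    EquiSemiconjugate f (itinerarySet f A W) (fun _ => shift A) (fun _ => univ) := by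
  choose h hh using fun n (x : itinerarySet f A W n) => x.2
  have huniq : ∀ n (x : itinerarySet f A W n) (α : Subshift A),
      (∀ k, iter f n k x ∈ W (α.1 k) (n + k)) → h n x = α := fun n x α hα =>
    Subtype.ext <| funext fun k => hsep _ _ _ _ (hh n x k) _ (hα k) (by simpa using hη)
  refine ⟨isInvariant_itinerarySet, fun _ => mapsTo_univ _ _, h, fun n => ?_, fun ε hε => ?_,
    fun n x => huniq _ _ _ (itinerary_apply (hh n x))⟩
  · refine eq_univ_of_forall fun α => ?_
    obtain ⟨x, hx⟩ := hne n α
    exact ⟨⟨x, α, hx⟩, huniq _ _ _ hx⟩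
  · obtain ⟨m, hm⟩ := exists_pow_lt_of_lt_one (half_pos hε) (by norm_num : (1 / 2 : ℝ) < 1)
    obtain ⟨δ, hδ, hd⟩ := exists_delta_iter hf m hη
    have hE : ∀ n (x : itinerarySet f A W n), ∀ k < m, iter f n k x ∈ ⋃ n, ⋃ i, W i n :=
      fun n x k _ => mem_iUnion₂.2 ⟨_, _, hh n x k⟩
    refine ⟨δ, hδ, fun n x y hxy => ?_⟩
    have hle : dist (h n x) (h n y) ≤ 2 * (1 / 2) ^ m := dist_subshift_le fun k hk =>
      hsep _ _ _ _ (hh n x k) _ (hh n y k) (hd n x y (hE n x) (hE n y) hxy k hk.le)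
    linarith

/-- A cover by small sets needs at least as many elements as there are admissible words. -/
theorem card_words_le_minCard [MetricSpace X] (hA : IsTransitionMatrix A) {η : ℝ}
    (hsep : ∀ i j n, ∀ x ∈ W i n, ∀ y ∈ W j n, dist x y < η → i = j)
    (hne : ∀ n (α : Subshift A), ∃ x, ∀ k, iter f n k x ∈ W (α.1 k) (n + k))
    {C : Set (Set X)} (hC : ∀ U ∈ C, ∀ x ∈ U, ∀ y ∈ U, dist x y < η) (n : ℕ) :
    ((Finset.univ.biUnion (words A n)).card : ℕ∞) ≤
      minCard (trace (iterCover f C (n + 1)) (itinerarySet f A W 0)) (itinerarySet f A W 0) := by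
  refine le_sInf ?_
  rintro _ ⟨D, hD, hcov, rfl⟩
  have hx : ∀ w ∈ Finset.univ.biUnion (words A n), ∃ x, ∃ B ∈ D, x ∈ B ∧
      ∀ j : Fin (n + 1), iter f 0 j x ∈ W (w j) (0 + j) := by
    intro w hw
    obtain ⟨i, -, hw⟩ := Finset.mem_biUnion.1 hw
    obtain ⟨α, hα⟩ := hA.exists_extension w (Finset.mem_filter.1 hw).2.2
    obtain ⟨x, hx⟩ := hne 0 α
    obtain ⟨B, hB, hxB⟩ := hcov (show x ∈ itinerarySet f A W 0 from ⟨α, hx⟩)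
    exact ⟨x, B, hB, hxB, fun j => hα j ▸ hx j⟩
  choose! x B hB hxB hit using hx
  rw [← Set.encard_coe_eq_coe_finsetCard]
  -- Two words assigned the same cover element have witnesses whose orbits are `η`-close at times
  -- `0, …, n`, hence the same letters.
  refine Set.encard_le_encard_of_injOn (f := B) (fun w hw => hB w hw) fun w hw w' hw' hww' => ?_
  obtain ⟨_, ⟨a, ha, rfl⟩, hBa⟩ := hD (hB w hw)
  have h1 := hxB w hw
  have h2 := hxB w' hw'
  rw [← hww'] at h2
  rw [← hBa] at h1 h2
  funext j
  exact hsep _ _ _ _ (hit w hw j) _ (hit w' hw' j)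
    (hC _ (ha j) _ (mem_iInter.1 h1.1 j) _ (mem_iInter.1 h2.1 j))

theorem log_rho_le_entropy [MetricSpace X] (hA : IsTransitionMatrix A) {η : ℝ} (hη : 0 < η)
    (hsep : ∀ i j n, ∀ x ∈ W i n, ∀ y ∈ W j n, dist x y < η → i = j)
    (hne : ∀ n (α : Subshift A), ∃ x, ∀ k, iter f n k x ∈ W (α.1 k) (n + k)) :
    ((Real.log (rho A) : ℝ) : EReal) ≤ entropy f (itinerarySet f A W 0) := by
  let C : Set (Set X) := range fun x => Metric.ball x (η / 2)
  have hC : IsOpenCoverOf C := by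
    refine ⟨?_, eq_univ_of_forall fun x => ⟨_, ⟨x, rfl⟩, Metric.mem_ball_self (half_pos hη)⟩⟩
    rintro _ ⟨x, rfl⟩
    exact Metric.isOpen_ball
  have hsmall : ∀ U ∈ C, ∀ x ∈ U, ∀ y ∈ U, dist x y < η := by
    rintro _ ⟨z, rfl⟩ x hx y hy
    linarith [dist_triangle_right x y z, Metric.mem_ball.1 hx, Metric.mem_ball.1 hy]
  refine le_trans ?_ (le_iSup _ (⟨C, hC⟩ : {C : Set (Set X) // IsOpenCoverOf C}))
  have hlim : Tendsto (fun n : ℕ => ((Real.log (entrySum (A ^ (n - 1))) / n : ℝ) : EReal)) atTop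
      (𝓝 ((Real.log (rho A) : ℝ) : EReal)) :=
    (continuous_coe_real_ereal.tendsto _).comp hA.tendsto_log_entrySum_pred
  rw [← hlim.limsup_eq]
  refine limsup_le_limsup ?_
  filter_upwards [eventually_gt_atTop 0] with n hn
  obtain ⟨n, rfl⟩ := Nat.exists_eq_succ_of_ne_zero hn.ne'
  have h1 := one_le_entrySum_pow hA n
  rw [EReal.coe_div, Nat.succ_eq_add_one, Nat.add_sub_cancel,
    ← ENNReal.log_ofReal_of_pos (by positivity), EReal.coe_natCast]
  refine EReal.div_le_div_right_of_nonneg (Nat.cast_nonneg' _) (ENNReal.log_monotone ?_)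
  calc ENNReal.ofReal (entrySum (A ^ n))
      ≤ ENNReal.ofReal ((Finset.univ.biUnion (words A n)).card : ℝ) :=
        ENNReal.ofReal_le_ofReal (hA.entrySum_pow_le n)
    _ = (((Finset.univ.biUnion (words A n)).card : ℕ∞) : ℝ≥0∞) := by simp
    _ ≤ _ := ENat.toENNReal_le.2 (card_words_le_minCard hA hsep hne hsmall n)

end InvariantSets

end NDS

theorem theorem3p3 {X : Type*} [MetricSpace X] (f : ℕ → X → X)
    {N : ℕ} (A : Matrix (Fin N) (Fin N) ℕ) (hA : IsTransitionMatrix A)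
    (V : Fin N → Set X) (hV : ∀ i, (V i).Nonempty)
    (hVdist : ∀ i j, i ≠ j → 0 < setDist (V i) (V j))
    (W : Fin N → ℕ → Set X) (hW : ∀ i n, (W i n).Nonempty) (hWc : ∀ i n, IsCompact (W i n))
    (hWV : ∀ i n, W i n ⊆ V i)
    (hf : EquiContinuousIn (fun _ => ⋃ n, ⋃ i, W i n) (fun n x => f n x)) :
    ((∀ (m n : ℕ) (α : Subshift A), (cylinder f W α.1 m n).Nonempty) →
      ∃ Λ : ℕ → Set X,
        (∀ n, (Λ n).Nonempty ∧ IsCompact (Λ n) ∧ Λ n ⊆ ⋃ i, W i n) ∧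
        (∀ n, f n '' Λ n ⊆ Λ (n + 1)) ∧
        EquiSemiconjugate f Λ (fun _ => shift A) (fun _ => Set.univ) ∧
        (CompactSpace X → ((Real.log (rho A) : ℝ) : EReal) ≤ entropy f (Λ 0))) ∧
    (WeaklyCoupledExpanding f A W →
      ∃ Λ : ℕ → Set X,
        (∀ n, (Λ n).Nonempty ∧ IsCompact (Λ n) ∧ Λ n ⊆ ⋃ i, W i n) ∧
        (∀ n, f n '' Λ n = Λ (n + 1)) ∧
        EquiSemiconjugate f Λ (fun _ => shift A) (fun _ => Set.univ) ∧
        (CompactSpace X → ((Real.log (rho A) : ℝ) : EReal) ≤ entropy f (Λ 0))) := by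
  obtain ⟨η, hη, hsepV⟩ := exists_separation hVdist
  have hsep : ∀ i j n, ∀ x ∈ W i n, ∀ y ∈ W j n, dist x y < η → i = j :=
    fun i j n x hx y hy => hsepV i j x y (hWV i n hx) (hWV j n hy)
  have hdisj : ∀ i j n, ∀ x ∈ W i n, x ∈ W j n → i = j :=
    fun i j n x hx hx' => hsep i j n x hx x hx' (by simpa using hη)
  have key (hne : ∀ (m n : ℕ) (α : Subshift A), (cylinder f W α.1 m n).Nonempty) :
      (∀ n, (itinerarySet f A W n).Nonempty ∧ IsCompact (itinerarySet f A W n) ∧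
        itinerarySet f A W n ⊆ ⋃ i, W i n) ∧
      EquiSemiconjugate f (itinerarySet f A W) (fun _ => shift A) (fun _ => Set.univ) ∧
      ((Real.log (rho A) : ℝ) : EReal) ≤ entropy f (itinerarySet f A W 0) := by
    have hex : ∀ n (α : Subshift A), ∃ x, ∀ k, iter f n k x ∈ W (α.1 k) (n + k) :=
      fun n α => exists_forall_iter_mem hWc hf fun m => hne m n α
    obtain ⟨α⟩ := hA.nonempty_subshift
    refine ⟨fun n => ⟨?_, isCompact_itinerarySet hWc hdisj hf n, itinerarySet_subset n⟩,
      equiSemiconjugate_itinerarySet hη hsep hf hex, log_rho_le_entropy hA hη hsep hex⟩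
    obtain ⟨x, hx⟩ := hex n α
    exact ⟨x, α, hx⟩
  refine ⟨fun hne => ?_, fun hexp => ?_⟩
  · obtain ⟨h1, h2, h3⟩ := key hne
    exact ⟨_, h1, fun n => (isInvariant_itinerarySet n).image_subset, h2, fun _ => h3⟩
  · obtain ⟨h1, h2, h3⟩ := key fun m n α => hexp.cylinder_nonempty m n α
    exact ⟨_, h1, image_itinerarySet hA hexp, h2, fun _ => h3⟩
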